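/- An \emph{arena} is a finite, strongly connected directed graph $G=(V_{\mathrm{Max}}\sqcup V_{\mathrm{Min}},E)$ (parallel edges and loops allowed) with at least one vertex, in which every vertex has an outgoing edge and whose vertices are split between the players Max and Min. Given weights $w\in\mathbb{R}^E$ and a start vertex, the owner of the current vertex moves a pebble along an outgoing edge, forever; both players use positional strategies. The payoff of the resulting edge sequence $e_1,e_2,\dots$ is $\limsup_{t\to\infty}\frac1t\sum_{i=1}^t w(e_i)$, which Max maximizes and Min minimizes, and the value of the vertex is the max-min of the payoff. \emph{Solving} the mean payoff game $(G,w)$ means finding the set of vertices with nonnegative value. A \emph{linear decision tree} (LDT) is a finite binary tree in which each inner node $u$ carries an inequality $a_u^\top x\ge 0$ with $a_u\in\mathbb{Z}^E$ and each leaf carries a label in $\{0,1\}^V$; an input $x\in\mathbb{R}^E$ descends from the root according to the validity of the inequalities and the output is the label of the leaf it reaches. An \emph{LDT algorithm for mean payoff games} is a family $\{\mathcal{T}_G\}_{G\in\mathcal{G}}$ of LDTs, $\mathcal{G}$ being the set of all arenas, such that for every arena $G$ and every $w\in\mathbb{R}^E$ the output of $\mathcal{T}_G$ on $w$ is the indicator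 vector of the set of vertices of nonnegative value. The \emph{node subdivision} $\mathscr{N}(\mathcal{T}_G)$ is the partition of $\mathbb{R}^E$ into the relatively open cells (cones) of the arrangement of the hyperplanes $\{x: a_u^\top x=0\}$, $u$ ranging over the inner nodes of $\mathcal{T}_G$: a cell consists of the vectors with one common sign in $\{-,0,+\}$ of $a_u^\top x$ for every $u$. A \emph{core preserving reduction} is a function $f_G\colon\mathbb{Z}^E\to\mathbb{Z}^E$ such that for every $z\in\mathbb{Z}^E$ we have $\|f_G(z)\|_\infty\le\|z\|_\infty$ and, for every cone $F\in\mathscr{N}(\mathcal{T}_G)$, $z\in F\Leftrightarrow f_G(z)\in F$. The \emph{representability measure} is \[ \mathrm{RM}(\mathcal{T}_G)=\max_{z\in\mathbb{Z}^E}\ \min\{\|f_G(z)\|_\infty : f_G \text{ a core preserving reduction}\}. \] \textbf{Theorem.} There exist a sequence of arenas $(G_i)_{i\in\mathbb{N}}$ with strictly increasing numbers of edges $(m_i)_{i\in\mathbb{N}}$ and a constant $c>0$ such that, for every $i\in\mathbb{N}$ and every LDT algorithm $\{\mathcal{T}_G\}_{G\in\mathcal{G}}$ for mean payoff games, \[ \mathrm{RM}(\mathcal{T}_{G_i})>2^{c\,m_i}.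 \] -/

import Mathlib

namespace MeanPayoff

/-- An arena: a finite directed multigraph (parallel edges and loops allowed), with its vertices
split into those of player Max and those of player Min (the complement), in which every vertex has
an outgoing edge. Arenas are strongly connected. -/
structure Arena where
  V : Type
  E : Type
  [fintypeV : Fintype V]
  [fintypeE : Fintype E]
  [nonemptyV : Nonempty V]
  src : E → V
  tgt : E → V
  /-- the vertices controlled by player Max; the others are controlled by player Min -/
  maxVerts : Set V
  exists_out : ∀ v, ∃ e, src e = v
  stronglyConnected : ∀ u v, Relation.ReflTransGen (fun a b => ∃ e, src e = a ∧ tgt e = b) u v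

attribute [instance] Arena.fintypeV Arena.fintypeE Arena.nonemptyV

namespace Arena

variable (G : Arena)

/-- Positional strategies of player Max: an outgoing edge at every vertex of Max
(an edge rather than a successor vertex, because of parallel edges). -/
abbrev MaxStrategy : Type := ∀ v : {v : G.V // v ∈ G.maxVerts}, {e : G.E // G.src e = v.1}

/-- Positional strategies of player Min. -/
abbrev MinStrategy : Type := ∀ v : {v : G.V // v ∉ G.maxVerts}, {e : G.E // G.src e = v.1}

variable {G}

open Classical in
/-- The edge along which the pebble leaves `v` under the strategies `σ` and `τ`. -/
noncomputable def move (σ : G.MaxStrategy) (τ : G.MinStrategy) (v : G.V) : G.E :=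
  if h : v ∈ G.maxVerts then (σ ⟨v, h⟩).1 else (τ ⟨v, h⟩).1

/-- The position of the pebble after `t` moves. -/
noncomputable def position (σ : G.MaxStrategy) (τ : G.MinStrategy) (v₀ : G.V) : ℕ → G.V
  | 0 => v₀
  | t + 1 => G.tgt (move σ τ (position σ τ v₀ t))

/-- The mean payoff: the limit superior of the average weight of the first `t` edges traversed. -/
noncomputable def outcome (w : G.E → ℝ) (σ : G.MaxStrategy) (τ : G.MinStrategy) (v₀ : G.V) : ℝ :=
  Filter.limsup
    (fun t : ℕ => (∑ i ∈ Finset.range t, w (move σ τ (position σ τ v₀ i))) / (t : ℝ)) Filter.atTop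

/-- The value of the mean payoff game with weights `w` started at `v₀` (maximum over the strategies
of Max of the minimum over those of Min; there are finitely many strategies and at least one for
each player). -/
noncomputable def value (w : G.E → ℝ) (v₀ : G.V) : ℝ :=
  ⨆ σ : G.MaxStrategy, ⨅ τ : G.MinStrategy, outcome w σ τ v₀

end Arena

/-- Linear decision trees with inputs indexed by `ι` and output in `{0,1}^κ`. An inner node carries
the homogeneous inequality `∑ e, a e * x e ≥ 0` with integer coefficients. -/
inductive LDT (ι κ : Type) : Type
  | leaf (label : κ → Bool) : LDT ι κ
  | node (a : ι → ℤ) (yes no : LDT ι κ) : LDT ι κ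

namespace LDT

variable {ι κ : Type} [Fintype ι]

/-- The linear form with integer coefficients `a`. -/
def form (a : ι → ℤ) (x : ι → ℝ) : ℝ := ∑ e, (a e : ℝ) * x e

open Classical in
/-- The label of the leaf that the input `x` reaches. -/
noncomputable def eval : LDT ι κ → (ι → ℝ) → κ → Bool
  | leaf label, _ => label
  | node a yes no, x => if 0 ≤ form a x then yes.eval x else no.eval x

/-- The coefficient vectors at the inner nodes of the tree. -/
def coeffs : LDT ι κ → Set (ι → ℤ)
  | leaf _ => ∅
  | node a yes no => insert a (yes.coeffs ∪ no.coeffs)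

/-- The node subdivision: the (relatively open, pairwise disjoint) cells of the arrangement of the
hyperplanes `form a x = 0`, for `a` ranging over the inner nodes. -/
def nodeSubdivision (T : LDT ι κ) : Set (Set (ι → ℝ)) :=
  {F | F.Nonempty ∧ ∃ s : (ι → ℤ) → SignType,
    F = {x | ∀ a ∈ T.coeffs, SignType.sign (form a x) = s a}}

/-- `f` is a core preserving reduction for the tree `T`: it keeps every integer vector in its cone
of the node subdivision and does not increase the maximum norm. (A core preserving reduction for a
family of trees is a family of such functions, one for each tree.) -/
def IsCorePreserving (T : LDT ι κ) (f : (ι → ℤ) → (ι → ℤ)) : Prop :=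
  ∀ z : ι → ℤ,
    (∀ F ∈ T.nodeSubdivision, (fun e => (z e : ℝ)) ∈ F ↔ (fun e => (f z e : ℝ)) ∈ F) ∧
    ‖f z‖ ≤ ‖z‖

theorem isCorePreserving_id (T : LDT ι κ) : T.IsCorePreserving id :=
  fun _ => ⟨fun _ _ => Iff.rfl, le_rfl⟩

/-- The representability measure: the maximum over all integer vectors `z` of the minimum of
`‖f z‖` (maximum norm) over all core preserving reductions `f`. The infimum is over a nonempty set
of nonnegative integers. The supremum is a maximum because there are finitely many cones; were the
set unbounded, its real supremum would be `0`, so a positive lower bound on this quantity is never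
true by convention. -/
noncomputable def representabilityMeasure (T : LDT ι κ) : ℝ :=
  ⨆ z : ι → ℤ, ⨅ f : {f : (ι → ℤ) → (ι → ℤ) // T.IsCorePreserving f}, ‖f.1 z‖

end LDT

/-- The tree solves every mean payoff game on `G`: given the weights, it returns the indicator
vector of the set of vertices with nonnegative value. -/
def Solves (G : Arena) (T : LDT G.E G.V) : Prop :=
  ∀ (w : G.E → ℝ) (v : G.V), T.eval w v = true ↔ 0 ≤ G.value w v

/-- An LDT algorithm for mean payoff games: for every arena, a linear decision tree that solves all
mean payoff games on this arena. -/
structure LDTAlgorithm where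
  tree : ∀ G : Arena, LDT G.E G.V
  solves : ∀ G : Arena, Solves G (tree G)

end MeanPayoff

open Filter Topology

namespace MeanPayoff

/-! ### Cones of a decision tree and the hyperplanes it must contain -/

namespace LDT

variable {ι κ : Type}

/-! Take a directed cycle of `n + 1` vertices, all owned by Max, with three parallel edges, labelled
`-1, 0, 1`, at each step. A strategy is a choice `χ` of labels, and the value is nonnegative iff
some `χ` has nonnegative total weight.

Each of these sums is indispensable: near suitable weights the accepted region is exactly its
half-space, so a tree must contain a nonzero multiple of it (`exists_mem_coeffs_form_eq_mul_sum`).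
Hence a cone of the node subdivision fixes the signs of all cycle sums.

For the weights `σ * 2 ^ k`, these signs force every integer vector `y` in the same cone to have
gaps `s k = y (k, 1) - y (k, -1)` larger than the sum of all earlier gaps. So `s n ≥ 2 ^ n` and `‖y‖
≥ 2 ^ n / 2`, while the arena has only `3 * (n + 1)` edges. -/

theorem finite_coeffs (T : LDT ι κ) : T.coeffs.Finite := by
  induction T with
  | leaf l => exact Set.finite_empty
  | node a y n hy hn => exact (hy.union hn).insert a

variable [Fintype ι]

theorem form_add (a : ι → ℤ) (x y : ι → ℝ) : form a (x + y) = form a x + form a y := by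
  simp [form, mul_add, Finset.sum_add_distrib]

theorem form_smul (a : ι → ℤ) (c : ℝ) (x : ι → ℝ) : form a (c • x) = c * form a x := by
  simp only [form, Pi.smul_apply, smul_eq_mul, Finset.mul_sum]
  exact Finset.sum_congr rfl fun _ _ => by ring

theorem continuous_form (a : ι → ℤ) : Continuous (form a) := by
  unfold form
  fun_prop

theorem eval_congr (T : LDT ι κ) {x y : ι → ℝ}
    (h : ∀ a ∈ T.coeffs, SignType.sign (form a x) = SignType.sign (form a y)) :
    T.eval x = T.eval y := by
  induction T with
  | leaf l => rfl
  | node a t f ht hf =>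
    have ha : 0 ≤ form a x ↔ 0 ≤ form a y := by
      rw [← sign_nonneg_iff, h a (Set.mem_insert _ _), sign_nonneg_iff]
    have h1 := ht fun b hb => h b (Set.mem_insert_of_mem _ (Or.inl hb))
    have h2 := hf fun b hb => h b (Set.mem_insert_of_mem _ (Or.inr hb))
    simp only [eval, ha, h1, h2]

/-- The cone of the node subdivision in which a vector lies. -/
theorem cell_mem_nodeSubdivision (T : LDT ι κ) (x : ι → ℝ) :
    {y | ∀ a ∈ T.coeffs, SignType.sign (form a y) = SignType.sign (form a x)}
      ∈ T.nodeSubdivision :=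
  ⟨⟨x, fun _ _ => rfl⟩, fun a => SignType.sign (form a x), rfl⟩

theorem IsCorePreserving.sign_form {T : LDT ι κ} {f : (ι → ℤ) → (ι → ℤ)}
    (hf : T.IsCorePreserving f) (z : ι → ℤ) {a : ι → ℤ} (ha : a ∈ T.coeffs) :
    SignType.sign (form a fun e => (f z e : ℝ)) = SignType.sign (form a fun e => (z e : ℝ)) :=
  (((hf z).1 _ (T.cell_mem_nodeSubdivision _)).1 fun _ _ => rfl) a ha

/-- Replacing vectors by shorter ones with the same signs at the inner nodes is core preserving. -/
theorem isCorePreserving_ite (T : LDT ι κ) (r : (ι → ℤ) → (ι → ℤ))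
    (hr : ∀ z, ∀ a ∈ T.coeffs, SignType.sign (form a fun e => (r z e : ℝ)) =
      SignType.sign (form a fun e => (z e : ℝ))) :
    T.IsCorePreserving fun z => if ‖r z‖ ≤ ‖z‖ then r z else z := by
  intro z
  dsimp only
  split_ifs with h
  · refine ⟨?_, h⟩
    rintro F ⟨-, s, rfl⟩
    exact forall₂_congr fun a ha => by rw [hr z a ha]
  · exact ⟨fun _ _ => Iff.rfl, le_rfl⟩

/-- Only finitely many sign patterns occur at the nodes. One fixed integer representative per
pattern, used whenever it is no longer than `z`, bounds all the minima. -/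
theorem bddAbove_range_iInf_norm (T : LDT ι κ) :
    BddAbove (Set.range fun z : ι → ℤ =>
      ⨅ f : {f : (ι → ℤ) → (ι → ℤ) // T.IsCorePreserving f}, ‖f.1 z‖) := by
  classical
  have : Finite T.coeffs := T.finite_coeffs
  obtain ⟨key, hkey⟩ : ∃ key : (ι → ℤ) → (T.coeffs → SignType), ∀ z (a : T.coeffs),
      key z a = SignType.sign (form a.1 fun e => (z e : ℝ)) := ⟨_, fun _ _ => rfl⟩
  have hr : ∀ z, key (Function.invFun key (key z)) = key z := fun z =>
    Function.invFun_eq ⟨z, rfl⟩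
  have hg := T.isCorePreserving_ite (fun z => Function.invFun key (key z)) fun z a ha => by
    rw [← hkey _ ⟨a, ha⟩, ← hkey _ ⟨a, ha⟩, hr]
  obtain ⟨M, hM⟩ := (Set.finite_range fun k => ‖Function.invFun key k‖).bddAbove
  refine ⟨M, ?_⟩
  rintro _ ⟨z, rfl⟩
  refine (ciInf_le ⟨0, by rintro _ ⟨f, rfl⟩; exact norm_nonneg _⟩ ⟨_, hg⟩).trans ?_
  refine le_trans ?_ (hM (Set.mem_range_self (key z)))
  dsimp only
  split_ifs with h
  exacts [le_rfl, (not_le.1 h).le]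

/-- A lower bound on the norm of all integer vectors in the cone of `z` bounds the
representability measure. -/
theorem le_representabilityMeasure (T : LDT ι κ) (z : ι → ℤ) {B : ℝ}
    (h : ∀ y : ι → ℤ, (∀ a ∈ T.coeffs, SignType.sign (form a fun e => (y e : ℝ)) =
      SignType.sign (form a fun e => (z e : ℝ))) → B ≤ ‖y‖) :
    B ≤ T.representabilityMeasure := by
  have : Nonempty {f : (ι → ℤ) → (ι → ℤ) // T.IsCorePreserving f} :=
    ⟨⟨id, T.isCorePreserving_id⟩⟩
  exact (le_ciInf fun f => h _ fun a ha => f.2.sign_form z ha).trans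
    (le_ciSup T.bddAbove_range_iInf_norm z)

/-- A hyperplane that bounds the accepted region near some point is, up to scaling, the hyperplane
of an inner node. -/
theorem exists_mem_coeffs_form_eq_mul (T : LDT ι κ) (v : κ) (b : ι → ℤ) (w p : ι → ℝ)
    (hw : form b w = 0) (hp : 0 < form b p)
    (hT : ∀ᶠ x in 𝓝 w, (T.eval x v = true ↔ 0 ≤ form b x)) :
    ∃ a ∈ T.coeffs, ∃ c : ℝ, c ≠ 0 ∧ ∀ x, form a x = c * form b x := by
  by_contra! hno
  let φ : (ι → ℤ) → Module.Dual ℝ (ι → ℝ) := fun a =>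
    { toFun := form a, map_add' := form_add a, map_smul' := form_smul a }
  let S : Set (ι → ℤ) := {a ∈ T.coeffs | ∃ x, form a x ≠ 0}
  have : Finite S := T.finite_coeffs.subset fun a ha => ha.1
  -- A form vanishing on the kernel of `form b` is a multiple of `form b`; the factor is read off at
  -- `p`.
  have hS : ∀ a : S, ∃ x ∈ LinearMap.ker (φ b), φ a x ≠ 0 := by
    rintro ⟨a, ha, x, hx⟩
    by_contra! hker
    have hpr : ∀ y, form a y = form a p / form b p * form b y := by
      intro y
      have h1 : form a (y + (-(form b y / form b p)) • p) = 0 := by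
        refine hker _ ?_
        change form b _ = 0
        rw [form_add, form_smul]
        field_simp
        ring
      rw [form_add, form_smul] at h1
      field_simp at h1 ⊢
      linarith
    obtain ⟨y, hy⟩ := hno a ha (form a p / form b p) (by
      intro h0
      rw [hpr, h0, zero_mul] at hx
      exact hx rfl)
    exact hy (hpr y)
  -- Finitely many proper subspaces do not cover the kernel of `form b`, so one direction `u` avoids
  -- them all.
  obtain ⟨u, hbu, hu⟩ := Module.Dual.exists_forall_mem_ne_zero_of_forall_exists _ _ hS
  replace hbu : form b u = 0 := hbu
  replace hu : ∀ a ∈ T.coeffs, (∃ x, form a x ≠ 0) → form a u ≠ 0 :=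
    fun a ha hx => hu ⟨a, ha, hx⟩
  have hlim : ∀ x y : ι → ℝ, Tendsto (fun t : ℝ => x + t • y) (𝓝[>] 0) (𝓝 x) := by
    intro x y
    have : Tendsto (fun t : ℝ => x + t • y) (𝓝 0) (𝓝 (x + (0 : ℝ) • y)) :=
      (by fun_prop : Continuous fun t : ℝ => x + t • y).tendsto 0
    rw [zero_smul, add_zero] at this
    exact this.mono_left nhdsWithin_le_nhds
  have hne : ∀ c d : ℝ, d ≠ 0 → ∀ᶠ t : ℝ in 𝓝[>] 0, c + t * d ≠ 0 := by
    intro c d hd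
    rcases eq_or_ne c 0 with rfl | hc
    · filter_upwards [self_mem_nhdsWithin] with t ht
      simpa [hd] using (ne_of_gt ht)
    · have : Tendsto (fun t : ℝ => c + t * d) (𝓝 0) (𝓝 (c + 0 * d)) :=
        (by fun_prop : Continuous fun t : ℝ => c + t * d).tendsto 0
      rw [zero_mul, add_zero] at this
      exact (this.mono_left nhdsWithin_le_nhds).eventually_ne hc
  have e1 : ∀ᶠ t : ℝ in 𝓝[>] 0, ∀ a ∈ T.coeffs, (∃ x, form a x ≠ 0) →
      form a (w + t • u) ≠ 0 := by
    refine T.finite_coeffs.eventually_all.2 fun a ha => ?_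
    by_cases hx : ∃ x, form a x ≠ 0
    · filter_upwards [hne (form a w) _ (hu a ha hx)] with t ht _
      rwa [form_add, form_smul]
    · exact Eventually.of_forall fun t h => (hx h).elim
  -- A small move along `u` stays on the hyperplane of `b` and leaves every hyperplane of the tree.
  obtain ⟨t, ht1, ht2⟩ := (e1.and ((hlim w u).eventually hT.eventually_nhds)).exists
  set w' := w + t • u with hw'
  have hbw' : form b w' = 0 := by rw [hw', form_add, form_smul, hw, hbu]; ring
  have e2 : ∀ᶠ x in 𝓝 w', ∀ a ∈ T.coeffs,
      SignType.sign (form a x) = SignType.sign (form a w') := by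
    refine T.finite_coeffs.eventually_all.2 fun a ha => ?_
    by_cases hx : ∃ x, form a x ≠ 0
    · have hc := (continuous_form a).tendsto w'
      rcases lt_or_gt_of_ne (ht1 a ha hx) with h | h
      · filter_upwards [hc.eventually_lt_const h] with x hx
        rw [sign_neg h, sign_neg hx]
      · filter_upwards [hc.eventually_const_lt h] with x hx
        rw [sign_pos h, sign_pos hx]
    · push Not at hx
      exact Eventually.of_forall fun x => by rw [hx, hx]
  -- The tree is constant near `w'`, yet a small step along `-p` makes `form b` negative and should
  -- change the answer.
  obtain ⟨s, ⟨hs1, hs2⟩, hs0⟩ :=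
    (((hlim w' (-p)).eventually (e2.and ht2)).and self_mem_nhdsWithin).exists
  have hev : T.eval w' v = true := ht2.self_of_nhds.2 hbw'.ge
  rw [← T.eval_congr hs1, hs2, form_add, form_smul, hbw', ← neg_one_smul ℝ p, form_smul] at hev
  nlinarith [mul_pos (Set.mem_Ioi.1 hs0) hp]

end LDT

/-! ### Averages along a cyclic walk -/

theorem sum_zmod_eq_sum_range {M : Type*} [AddCommMonoid M] (N : ℕ) [NeZero N] (f : ZMod N → M) :
    ∑ j, f j = ∑ i ∈ Finset.range N, f (i : ZMod N) := by
  refine (Finset.sum_bij' (s := Finset.range N) (t := Finset.univ)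
    (fun i _ => (i : ZMod N)) (fun j _ => j.val) ?_ ?_ ?_ ?_ ?_).symm
  · exact fun _ _ => Finset.mem_univ _
  · exact fun j _ => Finset.mem_range.2 j.val_lt
  · exact fun i hi => ZMod.val_cast_of_lt (Finset.mem_range.1 hi)
  · exact fun j _ => ZMod.natCast_zmod_val j
  · exact fun _ _ => rfl

/-- The deviation of the partial sums from `t * A` is periodic, hence bounded, and vanishes after
division by `t`. -/
theorem tendsto_average_zmod (N : ℕ) [NeZero N] (g : ZMod N → ℝ) (v : ZMod N) :
    Tendsto (fun t : ℕ => (∑ i ∈ Finset.range t, g (v + (i : ZMod N))) / (t : ℝ)) atTop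
      (𝓝 ((∑ j, g j) / N)) := by
  have hN : (N : ℝ) ≠ 0 := Nat.cast_ne_zero.2 (NeZero.ne N)
  set A := (∑ j, g j) / N with hA
  let h : ℕ → ℝ := fun t => ∑ i ∈ Finset.range t, (g (v + (i : ZMod N)) - A)
  have hper : Function.Periodic h N := by
    intro t
    have h1 : ∑ i ∈ Finset.range N, g (v + ((t + i : ℕ) : ZMod N)) = ∑ j, g j := by
      rw [← Equiv.sum_comp (Equiv.addLeft (v + (t : ZMod N))) g, sum_zmod_eq_sum_range]
      exact Finset.sum_congr rfl fun i _ => by simp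
    simp only [h]
    rw [Finset.sum_range_add, add_eq_left, Finset.sum_sub_distrib, h1, hA]
    simp only [Finset.sum_const, Finset.card_range, nsmul_eq_mul]
    field_simp
    ring
  obtain ⟨C, hC⟩ : ∃ C, ∀ t, |h t| ≤ C := by
    obtain ⟨C, hC⟩ := ((Finset.range N).image fun i => |h i|).bddAbove
    refine ⟨C, fun t => ?_⟩
    rw [← hper.map_mod_nat t]
    exact hC (Finset.mem_coe.2 (Finset.mem_image_of_mem _
      (Finset.mem_range.2 (Nat.mod_lt _ (Nat.pos_of_ne_zero (NeZero.ne N))))))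
  have hlim : Tendsto (fun t : ℕ => h t / t) atTop (𝓝 0) := by
    refine squeeze_zero_norm (fun t => ?_) (tendsto_const_div_atTop_nhds_zero_nat C)
    rw [norm_div, Real.norm_eq_abs, Real.norm_natCast]
    exact div_le_div_of_nonneg_right (hC t) t.cast_nonneg
  have := hlim.add_const A
  rw [zero_add] at this
  refine this.congr' ?_
  filter_upwards [eventually_gt_atTop 0] with t ht
  have ht' : (t : ℝ) ≠ 0 := by positivity
  simp only [h, Finset.sum_sub_distrib, Finset.sum_const, Finset.card_range, nsmul_eq_mul]
  field_simp
  ring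

/-! ### The cyclic arenas -/

/-- A cycle of `n + 1` vertices, all of them owned by Max, with three parallel edges from each
vertex to the next. -/
def cyclicArena (n : ℕ) : Arena where
  V := ZMod (n + 1)
  E := ZMod (n + 1) × SignType
  src e := e.1
  tgt e := e.1 + 1
  maxVerts := Set.univ
  exists_out v := ⟨(v, 0), rfl⟩
  stronglyConnected u v := by
    have h : ∀ t : ℕ, Relation.ReflTransGen
        (fun a b : ZMod (n + 1) => ∃ e : ZMod (n + 1) × SignType, e.1 = a ∧ e.1 + 1 = b)
        u (u + t) := by
      intro t
      induction t with
      | zero => simpa using Relation.ReflTransGen.refl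
      | succ t ih => exact ih.tail ⟨(u + t, 0), rfl, by push_cast; ring⟩
    simpa using h (v - u).val

theorem card_cyclicArena_E (n : ℕ) : Fintype.card (cyclicArena n).E = (n + 1) * 3 := by
  change Fintype.card (ZMod (n + 1) × SignType) = _
  rw [Fintype.card_prod, ZMod.card]
  rfl

variable {n : ℕ}

/-- The strategy of Max that moves along the edge selected by `χ`. -/
def cyclicStrategy (χ : ZMod (n + 1) → SignType) : (cyclicArena n).MaxStrategy :=
  fun v => ⟨(v.1, χ v.1), rfl⟩

theorem cyclicStrategy_surjective :
    Function.Surjective (cyclicStrategy : (ZMod (n + 1) → SignType) → _) := by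
  intro σ
  refine ⟨fun v => (σ ⟨v, Set.mem_univ v⟩).1.2, funext fun v => Subtype.ext ?_⟩
  exact Prod.ext (σ v).2.symm rfl

theorem outcome_cyclicStrategy (w : ZMod (n + 1) × SignType → ℝ) (χ : ZMod (n + 1) → SignType)
    (τ : (cyclicArena n).MinStrategy) (v : ZMod (n + 1)) :
    Arena.outcome (G := cyclicArena n) w (cyclicStrategy χ) τ v =
      (∑ k, w (k, χ k)) / ((n + 1 : ℕ) : ℝ) := by
  have hmove : ∀ u : ZMod (n + 1),
      Arena.move (G := cyclicArena n) (cyclicStrategy χ) τ u = (u, χ u) :=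
    fun u => dif_pos (Set.mem_univ u)
  have hpos : ∀ t : ℕ,
      Arena.position (G := cyclicArena n) (cyclicStrategy χ) τ v t = v + (t : ZMod (n + 1)) := by
    intro t
    induction t with
    | zero => exact (by simp : v = v + ((0 : ℕ) : ZMod (n + 1)))
    | succ t ih =>
      change (cyclicArena n).tgt (Arena.move _ τ (Arena.position _ τ v t)) = _
      rw [ih, hmove]
      exact (by push_cast; ring :
        v + (t : ZMod (n + 1)) + 1 = v + ((t + 1 : ℕ) : ZMod (n + 1)))
  refine Tendsto.limsup_eq ((tendsto_average_zmod (n + 1) (fun k => w (k, χ k)) v).congr ?_)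
  intro t
  congr 1
  refine Finset.sum_congr rfl fun i _ => ?_
  rw [hpos i]
  exact (congrArg w (hmove _)).symm

theorem value_cyclicArena_nonneg_iff (w : ZMod (n + 1) × SignType → ℝ) (v : ZMod (n + 1)) :
    0 ≤ (cyclicArena n).value w v ↔ ∃ χ : ZMod (n + 1) → SignType, 0 ≤ ∑ k, w (k, χ k) := by
  have : Nonempty (cyclicArena n).MinStrategy := ⟨fun u => (u.2 (Set.mem_univ _)).elim⟩
  have hval : (cyclicArena n).value w v =
      ⨆ χ : ZMod (n + 1) → SignType, (∑ k, w (k, χ k)) / ((n + 1 : ℕ) : ℝ) := by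
    unfold Arena.value
    rw [← cyclicStrategy_surjective.iSup_comp]
    exact iSup_congr fun χ => by simp only [outcome_cyclicStrategy w χ _ v, ciInf_const]
  have hn : (0 : ℝ) < ((n + 1 : ℕ) : ℝ) := by positivity
  rw [hval]
  constructor
  · intro h
    obtain ⟨χ, hχ⟩ := exists_eq_ciSup_of_finite
      (f := fun χ : ZMod (n + 1) → SignType => (∑ k, w (k, χ k)) / ((n + 1 : ℕ) : ℝ))
    rw [← hχ] at h
    exact ⟨χ, by simpa using (le_div_iff₀ hn).1 h⟩
  · rintro ⟨χ, hχ⟩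
    exact (div_nonneg hχ hn.le).trans
      (le_ciSup (f := fun χ : ZMod (n + 1) → SignType => (∑ k, w (k, χ k)) / ((n + 1 : ℕ) : ℝ))
        (Set.finite_range _).bddAbove χ)

/-! ### Every cycle occurs in every decision tree -/

/-- The indicator vector of the cycle selected by `χ`. -/
def cycleVector (χ : ZMod (n + 1) → SignType) : ZMod (n + 1) × SignType → ℤ :=
  fun e => if e.2 = χ e.1 then 1 else 0

theorem form_cycleVector (χ : ZMod (n + 1) → SignType) (x : ZMod (n + 1) × SignType → ℝ) :
    LDT.form (cycleVector χ) x = ∑ k, x (k, χ k) := by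
  simp [LDT.form, cycleVector, Fintype.sum_prod_type]

theorem exists_mem_coeffs_form_eq_mul_sum (T : LDT (ZMod (n + 1) × SignType) (ZMod (n + 1)))
    (hT : Solves (cyclicArena n) T) (χ : ZMod (n + 1) → SignType) :
    ∃ a ∈ T.coeffs, ∃ c : ℝ, c ≠ 0 ∧ ∀ x, LDT.form a x = c * ∑ k, x (k, χ k) := by
  -- Here the cycle `χ` has weight `0` and every other cycle is strictly negative, so nearby only
  -- `χ` can be nonnegative.
  let w : ZMod (n + 1) × SignType → ℝ := fun e => if e.2 = χ e.1 then 0 else -1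
  have key := T.exists_mem_coeffs_form_eq_mul 0 (cycleVector χ) w (fun _ => 1)
    (by simp [form_cycleVector, w]) (by simp [form_cycleVector]; positivity) ?_
  · simpa only [form_cycleVector] using key
  · have hneg : ∀ᶠ x in 𝓝 w, ∀ ψ : ZMod (n + 1) → SignType, ψ ≠ χ → ∑ k, x (k, ψ k) < 0 := by
      rw [eventually_all]
      intro ψ
      by_cases hψ : ψ = χ
      · exact Eventually.of_forall fun _ h => (h hψ).elim
      · have hc : Continuous fun x : ZMod (n + 1) × SignType → ℝ => ∑ k, x (k, ψ k) := by fun_prop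
        have hw : ∑ k, w (k, ψ k) < 0 := by
          obtain ⟨j, hj⟩ := Function.ne_iff.1 hψ
          refine Finset.sum_neg' (fun k _ => ?_) ⟨j, Finset.mem_univ _, ?_⟩
          · simp only [w]; split_ifs <;> norm_num
          · simp [w, hj]
        filter_upwards [(hc.tendsto w).eventually_lt_const hw] with x hx _ using hx
    filter_upwards [hneg] with x hx
    rw [form_cycleVector]
    refine (hT x (0 : ZMod (n + 1))).trans ((value_cyclicArena_nonneg_iff x 0).trans ⟨?_, fun h => ⟨χ, h⟩⟩)
    rintro ⟨ψ, hψ⟩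
    by_contra h
    exact (hx ψ (by rintro rfl; exact h hψ)).not_ge hψ

theorem sign_sum_eq_of_sign_form_eq (T : LDT (ZMod (n + 1) × SignType) (ZMod (n + 1)))
    (hT : Solves (cyclicArena n) T) {x y : ZMod (n + 1) × SignType → ℝ}
    (h : ∀ a ∈ T.coeffs, SignType.sign (LDT.form a x) = SignType.sign (LDT.form a y))
    (χ : ZMod (n + 1) → SignType) :
    SignType.sign (∑ k, x (k, χ k)) = SignType.sign (∑ k, y (k, χ k)) := by
  obtain ⟨a, ha, c, hc, hform⟩ := exists_mem_coeffs_form_eq_mul_sum T hT χ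
  have := h a ha
  rw [hform, hform, sign_mul, sign_mul] at this
  exact mul_left_cancel₀ (sign_ne_zero.2 hc) this

/-! ### A weight vector in a cone without short integer vectors -/

/-- The cycle that takes the edge `σ` at `k`, the edge `-σ` below `k` and the edge `0` above. -/
def thresholdCycle (k : ℕ) (σ : SignType) (j : ZMod (n + 1)) : SignType :=
  if j.val = k then σ else if j.val < k then -σ else 0

theorem sum_thresholdCycle {M : Type*} [AddCommGroup M] (x : ZMod (n + 1) × SignType → M) {k : ℕ}
    (hk : k ≤ n) (σ : SignType) :
    ∑ j, x (j, thresholdCycle k σ j) = ∑ i ∈ Finset.range k, x (i, -σ) + x (k, σ) +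
      ∑ i ∈ Finset.Ico (k + 1) (n + 1), x (i, 0) := by
  rw [sum_zmod_eq_sum_range, ← Finset.sum_range_add_sum_Ico _ (Nat.succ_le_succ hk),
    Finset.sum_range_succ]
  have hval : ∀ i < n + 1, ((i : ZMod (n + 1))).val = i := fun i hi => ZMod.val_cast_of_lt hi
  congr 1
  · congr 1
    · refine Finset.sum_congr rfl fun i hi => ?_
      have := Finset.mem_range.1 hi
      rw [thresholdCycle, hval i (by omega), if_neg (by omega), if_pos this]
    · rw [thresholdCycle, hval k (by omega), if_pos rfl]
  · refine Finset.sum_congr rfl fun i hi => ?_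
    have := Finset.mem_Ico.1 hi
    rw [thresholdCycle, hval i (by omega), if_neg (by omega), if_neg (by omega)]

/-- The weights `σ * 2 ^ k`. -/
def powWeight (n : ℕ) : ZMod (n + 1) × SignType → ℤ := fun e => (e.2 : ℤ) * 2 ^ e.1.val

/-- The edges below `k` contribute `-σ * (2 ^ k - 1)` and the edge at `k` contributes `σ * 2 ^ k`.
-/
theorem sum_powWeight_thresholdCycle {k : ℕ} (hk : k ≤ n) (σ : SignType) :
    ∑ j, powWeight n (j, thresholdCycle k σ j) = σ := by
  have hval : ∀ i < n + 1, ((i : ZMod (n + 1))).val = i := fun i hi => ZMod.val_cast_of_lt hi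
  rw [sum_thresholdCycle _ hk]
  have h1 : ∑ i ∈ Finset.range k, powWeight n (i, -σ) = -(σ : ℤ) * (2 ^ k - 1) := by
    have h2 := geom_sum_mul (2 : ℤ) k
    rw [← h2, show (2 : ℤ) - 1 = 1 by norm_num, mul_one, Finset.mul_sum]
    refine Finset.sum_congr rfl fun i hi => ?_
    simp only [powWeight]
    rw [hval i (by have := Finset.mem_range.1 hi; omega), SignType.coe_neg]
  rw [h1]
  simp [powWeight, hval k (by omega)]
  ring

theorem two_pow_le_of_sum_lt {s : ℕ → ℤ} {n : ℕ}
    (h : ∀ k ≤ n, ∑ i ∈ Finset.range k, s i < s k) : ∀ k ≤ n, 2 ^ k ≤ s k := by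
  have hsum : ∀ k ≤ n + 1, 2 ^ k ≤ ∑ i ∈ Finset.range k, s i + 1 := by
    intro k
    induction k with
    | zero => simp
    | succ k ih =>
      intro hk
      have := ih (by omega)
      have := h k (by omega)
      rw [Finset.sum_range_succ, pow_succ]
      omega
  intro k hk
  have := hsum k (by omega)
  have := h k hk
  omega

theorem two_pow_le_two_mul_norm {y : ZMod (n + 1) × SignType → ℤ}
    (h : ∀ χ : ZMod (n + 1) → SignType, SignType.sign (∑ k, y (k, χ k)) =
      SignType.sign (∑ k, powWeight n (k, χ k))) : (2 : ℝ) ^ n ≤ 2 * ‖y‖ := by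
  -- The threshold cycles for `1` and `-1` have positive and negative sums; in their difference the
  -- `0` edges above `k` cancel.
  have hlt : ∀ k ≤ n, ∑ i ∈ Finset.range k, (y ((i : ℕ), 1) - y ((i : ℕ), -1)) <
      y ((k : ℕ), 1) - y ((k : ℕ), -1) := by
    intro k hk
    have h1 := h (thresholdCycle k 1)
    have h2 := h (thresholdCycle k (-1))
    rw [sum_powWeight_thresholdCycle hk, sum_thresholdCycle y hk] at h1 h2
    simp only [SignType.coe_one, SignType.coe_neg, sign_one, Left.sign_neg, neg_neg] at h1 h2
    rw [sign_eq_one_iff] at h1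
    rw [sign_eq_neg_one_iff] at h2
    rw [Finset.sum_sub_distrib]
    linarith
  have hn : (2 : ℤ) ^ n ≤ y ((n : ℕ), 1) - y ((n : ℕ), -1) :=
    two_pow_le_of_sum_lt (s := fun i => y ((i : ℕ), 1) - y ((i : ℕ), -1)) hlt n le_rfl
  have hn' : (2 : ℝ) ^ n ≤ (y ((n : ℕ), 1) : ℝ) - y ((n : ℕ), -1) := by exact_mod_cast hn
  have b1 := norm_le_pi_norm y ((n : ℕ), 1)
  have b2 := norm_le_pi_norm y ((n : ℕ), -1)
  rw [Int.norm_eq_abs] at b1 b2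
  linarith [le_abs_self (y ((n : ℕ), 1) : ℝ), neg_abs_le (y ((n : ℕ), -1) : ℝ)]

theorem two_pow_div_two_le_representabilityMeasure
    (T : LDT (ZMod (n + 1) × SignType) (ZMod (n + 1))) (hT : Solves (cyclicArena n) T) :
    (2 : ℝ) ^ n / 2 ≤ T.representabilityMeasure := by
  refine T.le_representabilityMeasure (powWeight n) fun y hy => ?_
  have := two_pow_le_two_mul_norm (y := y) fun χ => by
    have h1 := sign_sum_eq_of_sign_form_eq T hT hy χ
    have hcast : ∀ m : ℤ, SignType.sign (m : ℝ) = SignType.sign m := sign_intCast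
    rw [← Int.cast_sum, ← Int.cast_sum, hcast, hcast] at h1
    exact h1
  linarith

end MeanPayoff

theorem mainTheorem3 :
    ∃ (G : ℕ → MeanPayoff.Arena) (c : ℝ),
      StrictMono (fun i => Fintype.card (G i).E) ∧ 0 < c ∧
      ∀ (i : ℕ) (T : MeanPayoff.LDTAlgorithm),
        (T.tree (G i)).representabilityMeasure > (2 : ℝ) ^ (c * (Fintype.card (G i).E : ℝ)) := by
  -- With `n = i + 2` the bound is `2 ^ (i + 1)` and there are `3 * (i + 3)` edges; `c = 1 / 18`
  -- gives exponent `(i + 3) / 6 < i + 1`, including at `i = 0`.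
  refine ⟨fun i => MeanPayoff.cyclicArena (i + 2), 1 / 18, ?_, by norm_num, fun i T => ?_⟩
  · intro i j hij
    simp only [MeanPayoff.card_cyclicArena_E]
    omega
  · refine lt_of_lt_of_le ?_
      (MeanPayoff.two_pow_div_two_le_representabilityMeasure _ (T.solves _))
    rw [MeanPayoff.card_cyclicArena_E]
    have : (2 : ℝ) ^ (i + 2) / 2 = (2 : ℝ) ^ ((i : ℝ) + 1) := by
      rw [Real.rpow_add_one two_ne_zero, Real.rpow_natCast]
      ring
    rw [this]
    refine Real.rpow_lt_rpow_of_exponent_lt one_lt_two ?_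
    push_cast
    linarith [(Nat.cast_nonneg i : (0 : ℝ) ≤ i)]
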